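/- Let $K$ be a field, $n\ge 0$, and $R=K[x_1,\dots,x_n]$ with its $\mathbb{Z}^n$-grading. For a monomial ideal $I\subseteq R$ let $\beta_{s,\mathbf a}(I)$ denote its multigraded Betti numbers: if $\cdots\to F_1\to F_0\to I\to 0$ is a minimal multigraded free resolution, then $F_s\cong\bigoplus_{\mathbf a}R[-\mathbf a]^{\beta_{s,\mathbf a}(I)}$. Put $\beta_{s,j}(I)=\sum_{|\mathbf a|=j}\beta_{s,\mathbf a}(I)$, where $|\mathbf a|=a_1+\cdots+a_n$. For $\mathbf b\in\mathbb{Z}^n$ let $\operatorname{supp}(\mathbf b)=\{i : b_i\neq 0\}$. Let $I$ be a monomial ideal generated by monomials of degree $d$, and let $\mathbf u$ be a monomial that is strongly linear over $I$, i.e. $\deg\mathbf u=d-1$ and the colon ideal $I:\mathbf u$ is generated by variables. Write $I:\mathbf u=(x_i : i\in B)$ with $B\subseteq\{1,\dots,n\}$, let $A\subseteq\{1,\dots,n\}$ be any subset, and let $J=I+\mathbf u\,(x_i : i\in A)$. Then: (1) For all $s\ge 0$ and all $\mathbf a\in\mathbb{Z}_{\ge 0}^n$, $\beta_{s,\mathbf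 a}(J)=\beta_{s,\mathbf a}(I)+1$ if $|\mathbf a|=d+s$, $\mathbf a-\operatorname{mdeg}(\mathbf u)\in\{0,1\}^n$, and $\operatorname{supp}(\mathbf a-\operatorname{mdeg}(\mathbf u))$ is an $(s+1)$-element subset of $A\cup B$ that is not contained in $B$; otherwise $\beta_{s,\mathbf a}(J)=\beta_{s,\mathbf a}(I)$. (2) For all $s\ge 0$, $\displaystyle \beta_{s,d+s}(J)=\beta_{s,d+s}(I)+\binom{|A\cup B|}{s+1}-\binom{|B|}{s+1}.$ -/

import Mathlib

namespace MonomialBetti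

open MvPolynomial

/-- A monomial ideal generated in degree `d`: it is generated by monomials of degree `d`.
(A family of monomials is given by the set of their exponent vectors.) -/
def IsMonomialGeneratedInDegree {K : Type*} [Field K] {n : ℕ}
    (I : Ideal (MvPolynomial (Fin n) K)) (d : ℕ) : Prop :=
  ∃ S : Set (Fin n →₀ ℕ), (∀ m ∈ S, m.degree = d) ∧
    I = Ideal.span ((fun m => monomial m (1 : K)) '' S)

/-- The ideal `(x_i : i ∈ B)`. -/
noncomputable def varIdeal (K : Type*) [Field K] {n : ℕ} (B : Finset (Fin n)) :
    Ideal (MvPolynomial (Fin n) K) :=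
  Ideal.span (X '' (B : Set (Fin n)))

/-- The monomial with exponent vector `u` is strongly linear over the monomial ideal `I`
generated in degree `d`: it has degree `d - 1`, and `I : u` is generated by variables. -/
def IsStronglyLinear {K : Type*} [Field K] {n : ℕ}
    (I : Ideal (MvPolynomial (Fin n) K)) (d : ℕ) (u : Fin n →₀ ℕ) : Prop :=
  IsMonomialGeneratedInDegree I d ∧ u.degree + 1 = d ∧
    ∃ B : Finset (Fin n), I.colon {monomial u (1 : K)} = varIdeal K B

/-- A vector `v` of the free module `⨁ l, R[-δ l]` (with basis elements in the multidegrees `δ l`)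
is homogeneous of multidegree `a`. -/
def IsHomogeneousVec {K : Type*} [Field K] {n r : ℕ} (δ : Fin r → (Fin n →₀ ℕ))
    (a : Fin n →₀ ℕ) (v : Fin r → MvPolynomial (Fin n) K) : Prop :=
  ∀ l, ∀ m ∈ (v l).support, m + δ l = a

/-- A minimal multigraded free resolution `⋯ → F₂ → F₁ → F₀ → I → 0` of the ideal `I` over
`R = K[x₁, …, xₙ]`, where `F i = ⨁ k, R[-deg i k]` has finite rank. The differentials and the
augmentation `F₀ → I` preserve multidegrees, and minimality means that each differential
`F (i+1) → F i` has its image in `𝔪 F i`, with `𝔪 = (x₁, …, xₙ)`. As `I` is an `ℕⁿ`-graded module,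
the degrees that occur in a minimal resolution are in `ℕⁿ`. (By the Hilbert syzygy theorem
a minimal resolution has finite length; this need not be imposed.) -/
structure MinimalResolution {K : Type*} [Field K] {n : ℕ}
    (I : Ideal (MvPolynomial (Fin n) K)) where
  /-- the rank of `F i` -/
  rank : ℕ → ℕ
  /-- the multidegrees of the basis elements of `F i` -/
  deg : ∀ i, Fin (rank i) → (Fin n →₀ ℕ)
  /-- the augmentation `F₀ → I ⊆ R` -/
  aug : (Fin (rank 0) → MvPolynomial (Fin n) K) →ₗ[MvPolynomial (Fin n) K] MvPolynomial (Fin n) K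
  /-- the differentials `F (i+1) → F i` -/
  d : ∀ i, (Fin (rank (i + 1)) → MvPolynomial (Fin n) K) →ₗ[MvPolynomial (Fin n) K]
    (Fin (rank i) → MvPolynomial (Fin n) K)
  aug_homogeneous : ∀ k, ∀ m ∈ (aug (Pi.single k 1)).support, m = deg 0 k
  d_homogeneous : ∀ i k, IsHomogeneousVec (deg i) (deg (i + 1) k) (d i (Pi.single k 1))
  range_aug : LinearMap.range aug = I
  exact_zero : Function.Exact (d 0) aug
  exact_succ : ∀ i, Function.Exact (d (i + 1)) (d i)
  minimal : ∀ i v l, d i v l ∈ idealOfVars (Fin n) K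

/-- The number of summands `R[-a]` of `F s`. -/
def MinimalResolution.betti {K : Type*} [Field K] {n : ℕ}
    {I : Ideal (MvPolynomial (Fin n) K)} (F : MinimalResolution I) (s : ℕ)
    (a : Fin n →₀ ℕ) : ℕ :=
  (Finset.univ.filter fun k => F.deg s k = a).card

/-- The multigraded Betti number `β_{s,a}(I)` of a monomial ideal `I`: the number of summands
`R[-a]` of the `s`-th module of a minimal multigraded free resolution of `I`. Such a resolution
exists for every monomial ideal (`nonempty_minimalResolution` below), and the number does not
depend on it. The value for an ideal without such a resolution is of no relevance. -/
noncomputable def multigradedBetti {K : Type*} [Field K] {n : ℕ}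
    (I : Ideal (MvPolynomial (Fin n) K)) (s : ℕ) (a : Fin n →₀ ℕ) : ℕ :=
  open Classical in
  if h : Nonempty (MinimalResolution I) then (Classical.choice h).betti s a else 0

/-- The graded Betti number `β_{s,j}(I) = ∑_{|a| = j} β_{s,a}(I)`. -/
noncomputable def gradedBetti {K : Type*} [Field K] {n : ℕ}
    (I : Ideal (MvPolynomial (Fin n) K)) (s j : ℕ) : ℕ :=
  ∑ a ∈ (Finset.univ : Finset (Fin n)).finsuppAntidiag j, multigradedBetti I s a

/-! Existence of minimal multigraded free resolutions of monomial ideals. -/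

section Existence

/-- The component of multidegree `a` of a vector of `⨁ l, R[-δ l]`. -/
noncomputable def comp {K : Type*} [Field K] {n r : ℕ} (δ : Fin r → (Fin n →₀ ℕ))
    (a : Fin n →₀ ℕ) (v : Fin r → MvPolynomial (Fin n) K) : Fin r → MvPolynomial (Fin n) K :=
  open Classical in
  fun l => if δ l ≤ a then monomial (a - δ l) (coeff (a - δ l) (v l)) else 0

theorem coeff_comp {K : Type*} [Field K] {n r : ℕ} (δ : Fin r → (Fin n →₀ ℕ))
    (a : Fin n →₀ ℕ) (v : Fin r → MvPolynomial (Fin n) K) (l : Fin r) (m : Fin n →₀ ℕ) :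
    coeff m (comp δ a v l) = if m + δ l = a then coeff m (v l) else 0 := by
  classical
  unfold comp
  by_cases h : m + δ l = a
  · subst h
    simp
  · rw [if_neg h]
    split_ifs with h1
    · rw [coeff_monomial, if_neg]
      intro h2
      exact h (by rw [← h2, tsub_add_cancel_of_le h1])
    · simp

theorem isHomogeneousVec_comp {K : Type*} [Field K] {n r : ℕ} (δ : Fin r → (Fin n →₀ ℕ))
    (a : Fin n →₀ ℕ) (v : Fin r → MvPolynomial (Fin n) K) :
    IsHomogeneousVec δ a (comp δ a v) := by
  intro l m hm
  rw [mem_support_iff, coeff_comp] at hm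
  by_contra h
  simp [h] at hm

/-- The multidegrees in which a vector has a nonzero component. -/
noncomputable def degs {K : Type*} [Field K] {n r : ℕ} (δ : Fin r → (Fin n →₀ ℕ))
    (v : Fin r → MvPolynomial (Fin n) K) : Finset (Fin n →₀ ℕ) :=
  open Classical in
  Finset.univ.biUnion fun l => (v l).support.image fun m => m + δ l

theorem sum_comp {K : Type*} [Field K] {n r : ℕ} (δ : Fin r → (Fin n →₀ ℕ))
    (v : Fin r → MvPolynomial (Fin n) K) : ∑ a ∈ degs δ v, comp δ a v = v := by
  classical
  funext l
  ext m
  rw [Finset.sum_apply, coeff_sum]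
  simp only [coeff_comp]
  rw [Finset.sum_ite_eq]
  split_ifs with h
  · rfl
  · by_contra h0
    apply h
    simp only [degs, Finset.mem_biUnion, Finset.mem_image]
    exact ⟨l, Finset.mem_univ _, m, by rw [mem_support_iff]; exact fun h => h0 h.symm, rfl⟩

/-- The linear map with columns `g`. -/
noncomputable def colMap {K : Type*} [Field K] {n r t : ℕ}
    (g : Fin t → (Fin r → MvPolynomial (Fin n) K)) :
    (Fin t → MvPolynomial (Fin n) K) →ₗ[MvPolynomial (Fin n) K]
      (Fin r → MvPolynomial (Fin n) K) :=
  Fintype.linearCombination (MvPolynomial (Fin n) K) g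

theorem colMap_apply {K : Type*} [Field K] {n r t : ℕ}
    (g : Fin t → (Fin r → MvPolynomial (Fin n) K)) (c : Fin t → MvPolynomial (Fin n) K) :
    colMap g c = ∑ k, c k • g k := Fintype.linearCombination_apply _ _ _

theorem comp_colMap {K : Type*} [Field K] {n r t : ℕ} (δ : Fin r → (Fin n →₀ ℕ))
    (ε : Fin t → (Fin n →₀ ℕ)) (g : Fin t → (Fin r → MvPolynomial (Fin n) K))
    (hg : ∀ k, IsHomogeneousVec δ (ε k) (g k)) (a : Fin n →₀ ℕ)
    (c : Fin t → MvPolynomial (Fin n) K) :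
    comp δ a (colMap g c) = colMap g (comp ε a c) := by
  classical
  funext l
  ext m
  rw [coeff_comp, colMap_apply, colMap_apply]
  simp only [Finset.sum_apply, Pi.smul_apply, smul_eq_mul, coeff_sum, coeff_mul, coeff_comp]
  have key : ∀ k, ∀ x ∈ Finset.HasAntidiagonal.antidiagonal m, coeff x.2 (g k l) ≠ 0 →
      (x.1 + ε k = a ↔ m + δ l = a) := by
    intro k x hx h0
    have h1 : x.2 + δ l = ε k := hg k l x.2 (mem_support_iff.mpr h0)
    rw [Finset.HasAntidiagonal.mem_antidiagonal] at hx
    rw [← h1, ← hx, add_assoc]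
  split_ifs with h
  · refine Finset.sum_congr rfl fun k _ => Finset.sum_congr rfl fun x hx => ?_
    by_cases h0 : coeff x.2 (g k l) = 0
    · simp [h0]
    · rw [if_pos ((key k x hx h0).mpr h)]
  · symm
    refine Finset.sum_eq_zero fun k _ => Finset.sum_eq_zero fun x hx => ?_
    by_cases h0 : coeff x.2 (g k l) = 0
    · simp [h0]
    · rw [if_neg (fun h2 => h ((key k x hx h0).mp h2)), zero_mul]

/-- A submodule of `⨁ l, R[-δ l]` is multigraded. -/
def IsGradedSub {K : Type*} [Field K] {n r : ℕ} (δ : Fin r → (Fin n →₀ ℕ))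
    (N : Submodule (MvPolynomial (Fin n) K) (Fin r → MvPolynomial (Fin n) K)) : Prop :=
  ∀ v ∈ N, ∀ a, comp δ a v ∈ N

theorem exists_homogeneous_generators {K : Type*} [Field K] {n r : ℕ}
    (δ : Fin r → (Fin n →₀ ℕ))
    (N : Submodule (MvPolynomial (Fin n) K) (Fin r → MvPolynomial (Fin n) K))
    (hN : IsGradedSub δ N) :
    ∃ t, ∃ (ε : Fin t → (Fin n →₀ ℕ)) (g : Fin t → (Fin r → MvPolynomial (Fin n) K)),
      (∀ k, IsHomogeneousVec δ (ε k) (g k)) ∧ Submodule.span _ (Set.range g) = N := by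
  classical
  obtain ⟨S, hS⟩ := IsNoetherian.noetherian N
  let T : Finset ((Fin n →₀ ℕ) × (Fin r → MvPolynomial (Fin n) K)) :=
    S.biUnion fun v => (degs δ v).image fun a => (a, comp δ a v)
  refine ⟨T.card, fun k => (T.equivFin.symm k).1.1, fun k => (T.equivFin.symm k).1.2, ?_, ?_⟩
  · intro k
    have h := (T.equivFin.symm k).2
    simp only [T, Finset.mem_biUnion, Finset.mem_image] at h
    obtain ⟨v, -, a, -, h⟩ := h
    change IsHomogeneousVec δ (T.equivFin.symm k).1.1 (T.equivFin.symm k).1.2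
    rw [← h]
    exact isHomogeneousVec_comp δ a v
  · apply le_antisymm
    · rw [Submodule.span_le]
      rintro _ ⟨k, rfl⟩
      have h := (T.equivFin.symm k).2
      simp only [T, Finset.mem_biUnion, Finset.mem_image] at h
      obtain ⟨v, hv, a, -, h⟩ := h
      change (T.equivFin.symm k).1.2 ∈ N
      rw [← h]
      exact hN v (by rw [← hS]; exact Submodule.subset_span hv) a
    · rw [← hS, Submodule.span_le]
      intro v hv
      rw [← sum_comp δ v]
      refine Submodule.sum_mem _ fun a ha => Submodule.subset_span ?_
      have hT : (a, comp δ a v) ∈ T := by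
        simp only [T, Finset.mem_biUnion, Finset.mem_image]
        exact ⟨v, hv, a, ha, rfl⟩
      exact ⟨T.equivFin ⟨_, hT⟩, by simp⟩

theorem exists_minimal_cover {K : Type*} [Field K] {n r : ℕ}
    (δ : Fin r → (Fin n →₀ ℕ))
    (N : Submodule (MvPolynomial (Fin n) K) (Fin r → MvPolynomial (Fin n) K))
    (hN : IsGradedSub δ N) :
    ∃ t, ∃ (ε : Fin t → (Fin n →₀ ℕ)) (g : Fin t → (Fin r → MvPolynomial (Fin n) K)),
      (∀ k, IsHomogeneousVec δ (ε k) (g k)) ∧ LinearMap.range (colMap g) = N ∧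
      IsGradedSub ε (LinearMap.ker (colMap g)) ∧
      ∀ c ∈ LinearMap.ker (colMap g), ∀ k, c k ∈ idealOfVars (Fin n) K := by
  classical
  have hex := exists_homogeneous_generators δ N hN
  obtain ⟨ε, g, hg, hspan⟩ := Nat.find_spec hex
  have hmin := fun t (ht : t < Nat.find hex) => Nat.find_min hex ht
  generalize Nat.find hex = t at ε g hmin
  have hgr : IsGradedSub ε (LinearMap.ker (colMap g)) := by
    intro c hc a
    rw [LinearMap.mem_ker] at hc ⊢
    rw [← comp_colMap δ ε g hg, hc]
    funext l
    ext m
    rw [coeff_comp]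
    simp
  refine ⟨t, ε, g, hg, ?_, hgr, ?_⟩
  · rw [colMap, Fintype.range_linearCombination, hspan]
  · intro c hc k
    by_contra hk
    have h0 : coeff 0 (c k) ≠ 0 := by
      intro h0
      apply hk
      rw [idealOfVars, ← Set.image_univ, mem_ideal_span_X_image]
      intro m hm
      by_contra! h
      have : m = 0 := by
        ext i
        exact h i (Set.mem_univ _)
      rw [this, mem_support_iff] at hm
      exact hm h0
    have hc' := hgr c hc (ε k)
    have hck : comp ε (ε k) c k = C (coeff 0 (c k)) := by
      simp [comp]
    rw [LinearMap.mem_ker, colMap_apply] at hc'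
    have hgk : g k ∈ Submodule.span (MvPolynomial (Fin n) K) (g '' {j | j ≠ k}) := by
      rw [← Finset.add_sum_erase _ _ (Finset.mem_univ k), hck] at hc'
      have h1 : (C (coeff 0 (c k)) : MvPolynomial (Fin n) K) • g k ∈
          Submodule.span (MvPolynomial (Fin n) K) (g '' {j | j ≠ k}) := by
        rw [eq_neg_of_add_eq_zero_left hc']
        refine Submodule.neg_mem _ (Submodule.sum_mem _ fun j hj => Submodule.smul_mem _ _ ?_)
        exact Submodule.subset_span ⟨j, (Finset.mem_erase.mp hj).1, rfl⟩
      have h2 := Submodule.smul_mem _ (C (coeff 0 (c k))⁻¹ : MvPolynomial (Fin n) K) h1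
      rwa [smul_smul, ← C_mul, inv_mul_cancel₀ h0, C_1, one_smul] at h2
    obtain _ | t := t
    · exact k.elim0
    refine hmin t (Nat.lt_succ_self t) ⟨fun j => ε (k.succAbove j), fun j => g (k.succAbove j),
      fun j => hg _, ?_⟩
    rw [← hspan]
    apply le_antisymm
    · apply Submodule.span_mono
      rintro _ ⟨j, rfl⟩
      exact ⟨_, rfl⟩
    · have hsub : g '' {j | j ≠ k} ⊆ Set.range fun j => g (k.succAbove j) := by
        rintro _ ⟨j, hj, rfl⟩
        obtain ⟨i, rfl⟩ := Fin.exists_succAbove_eq hj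
        exact ⟨i, rfl⟩
      rw [Submodule.span_le]
      rintro _ ⟨j, rfl⟩
      by_cases hj : j = k
      · rw [hj]
        exact Submodule.span_mono hsub hgk
      · exact Submodule.subset_span (hsub ⟨j, hj, rfl⟩)

/-- A multigraded submodule of a multigraded free module. -/
structure Stage (K : Type*) [Field K] (n : ℕ) where
  /-- the rank -/
  r : ℕ
  /-- the multidegrees -/
  δ : Fin r → (Fin n →₀ ℕ)
  /-- the submodule -/
  N : Submodule (MvPolynomial (Fin n) K) (Fin r → MvPolynomial (Fin n) K)
  graded : IsGradedSub δ N

theorem Stage.exists_next {K : Type*} [Field K] {n : ℕ} (S : Stage K n) :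
    ∃ T : Stage K n, ∃ g : Fin T.r → (Fin S.r → MvPolynomial (Fin n) K),
      (∀ k, IsHomogeneousVec S.δ (T.δ k) (g k)) ∧ LinearMap.range (colMap g) = S.N ∧
      LinearMap.ker (colMap g) = T.N ∧ ∀ c ∈ T.N, ∀ k, c k ∈ idealOfVars (Fin n) K := by
  obtain ⟨t, ε, g, h1, h2, h3, h4⟩ := exists_minimal_cover S.δ S.N S.graded
  exact ⟨⟨t, ε, _, h3⟩, g, h1, h2, rfl, h4⟩

theorem colMap_single {K : Type*} [Field K] {n r t : ℕ}
    (g : Fin t → (Fin r → MvPolynomial (Fin n) K)) (k : Fin t) :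
    colMap g (Pi.single k 1) = g k := by
  rw [colMap, Fintype.linearCombination_apply_single, one_smul]

/-- Every monomial ideal has a minimal multigraded free resolution. -/
theorem nonempty_minimalResolution {K : Type*} [Field K] {n : ℕ}
    (I : Ideal (MvPolynomial (Fin n) K)) (S : Set (Fin n →₀ ℕ))
    (hI : I = Ideal.span ((fun m => monomial m (1 : K)) '' S)) :
    Nonempty (MinimalResolution I) := by
  classical
  choose next g hg hrange hker hmin using fun T : Stage K n => T.exists_next
  let S₀ : Stage K n :=
    { r := 1
      δ := fun _ => 0
      N := Submodule.comap (LinearMap.proj (R := MvPolynomial (Fin n) K)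
        (φ := fun _ : Fin 1 => MvPolynomial (Fin n) K) 0) I
      graded := by
        intro v hv a
        rw [Submodule.mem_comap, LinearMap.proj_apply] at hv ⊢
        rw [hI, mem_ideal_span_monomial_image] at hv ⊢
        intro m hm
        refine hv m ?_
        rw [mem_support_iff, coeff_comp] at hm
        rw [mem_support_iff]
        intro h
        simp [h] at hm }
  let st : ℕ → Stage K n := fun i => next^[i] S₀
  have hst : ∀ i, st (i + 1) = next (st i) := fun i => Function.iterate_succ_apply' next i S₀
  have hall : ∀ i, ∃ g : Fin (st (i + 1)).r → (Fin (st i).r → MvPolynomial (Fin n) K),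
      (∀ k, IsHomogeneousVec (st i).δ ((st (i + 1)).δ k) (g k)) ∧
      LinearMap.range (colMap g) = (st i).N ∧ LinearMap.ker (colMap g) = (st (i + 1)).N ∧
      ∀ c ∈ (st (i + 1)).N, ∀ k, c k ∈ idealOfVars (Fin n) K := by
    intro i
    rw [hst i]
    exact ⟨g (st i), hg _, hrange _, hker _, hmin _⟩
  choose G hG hGr hGk hGm using hall
  let p : (Fin 1 → MvPolynomial (Fin n) K) ≃ₗ[MvPolynomial (Fin n) K] MvPolynomial (Fin n) K :=
    LinearEquiv.funUnique (Fin 1) _ _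
  let G₀ : Fin (st 1).r → (Fin 1 → MvPolynomial (Fin n) K) := G 0
  have hG₀ : ∀ k, IsHomogeneousVec (fun _ : Fin 1 => (0 : Fin n →₀ ℕ)) ((st 1).δ k) (G₀ k) := hG 0
  have hGr₀ : LinearMap.range (colMap G₀) = S₀.N := hGr 0
  have hGk₀ : LinearMap.ker (colMap G₀) = (st 1).N := hGk 0
  refine ⟨{
    rank := fun i => (st (i + 1)).r
    deg := fun i => (st (i + 1)).δ
    aug := p.toLinearMap ∘ₗ colMap G₀
    d := fun i => colMap (G (i + 1))
    aug_homogeneous := ?_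
    d_homogeneous := ?_
    range_aug := ?_
    exact_zero := ?_
    exact_succ := ?_
    minimal := ?_ }⟩
  · intro k m hm
    have h := hG₀ k 0 m
    rw [LinearMap.comp_apply] at hm
    erw [colMap_single G₀ k] at hm
    simpa using h hm
  · intro i k
    rw [colMap_single]
    exact hG (i + 1) k
  · rw [LinearMap.range_comp, hGr₀]
    ext f
    constructor
    · rintro ⟨v, hv, rfl⟩
      exact hv
    · intro hf
      exact ⟨fun _ => f, hf, rfl⟩
  · rw [LinearMap.exact_iff, LinearMap.ker_comp, LinearEquiv.ker, Submodule.comap_bot, hGr 1]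
    exact hGk₀
  · intro i
    rw [LinearMap.exact_iff, hGr, hGk]
  · intro i v l
    have h : colMap (G (i + 1)) v ∈ (st (i + 1)).N := by
      rw [← hGr (i + 1)]
      exact LinearMap.mem_range_self _ v
    exact hGm i _ h l

end Existence

end MonomialBetti

/-! The generators x^u x_i, i ∈ A, are adjoined to I one at a time. If i ∈ B, nothing changes, since
x^u x_i ∈ I. Otherwise let I' be the current ideal and A' the set of indices already treated. Then
I' : x^u = (x_j : j ∈ C) with C = A' ∪ B (`colon_add_span_mul`). If i ∉ C, then x_i is a
nonzerodivisor modulo this ideal, so multiplication by x^u x_i embeds a shift of R/(x_j : j ∈ C)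
into R/I' with cokernel R/(I' + (x^u x_i)). The mapping cone then resolves I' + (x^u x_i).

The cone is minimal because the comparison map can be taken as x_i times a lift of multiplication by
x^u, so its entries lie in 𝔪 (`exists_cone`). Betti numbers therefore add. The new summands in
homological degree s correspond to the s-subsets of C, with multidegrees shifted by u + e_i, that
is, to the (s+1)-subsets of C ∪ {i} containing i. Over all steps these are the (s+1)-subsets of A ∪
B not contained in B.

The resolution of (x_j : j ∈ C) comes from the same cone with u = 0, which builds the Koszul complex
(`exists_of_varIdeal`). Since Betti numbers are defined through a chosen resolution, `betti_le` is
needed to compute them from the constructed one. -/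

namespace MonomialBetti

open MvPolynomial

/-! ### Homogeneous vectors and homogeneous lifts -/

section Homogeneous

variable {K : Type*} [Field K] {n r t p : ℕ}

theorem eq_colMap (f : (Fin t → MvPolynomial (Fin n) K) →ₗ[MvPolynomial (Fin n) K]
      (Fin r → MvPolynomial (Fin n) K)) :
    f = colMap fun k => f (Pi.single k 1) := by
  refine LinearMap.pi_ext' fun k => LinearMap.ext_ring ?_
  simp [colMap_single]

theorem map_eq_sum (f : (Fin t → MvPolynomial (Fin n) K) →ₗ[MvPolynomial (Fin n) K]
      (Fin r → MvPolynomial (Fin n) K)) (v : Fin t → MvPolynomial (Fin n) K) :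
    f v = ∑ k, v k • f (Pi.single k 1) := by
  conv_lhs => rw [eq_colMap f, colMap_apply]

theorem IsHomogeneousVec.zero (δ : Fin r → (Fin n →₀ ℕ)) (a : Fin n →₀ ℕ) :
    IsHomogeneousVec (K := K) δ a 0 := by
  intro l m hm
  simp at hm

theorem IsHomogeneousVec.neg {δ : Fin r → (Fin n →₀ ℕ)} {a : Fin n →₀ ℕ}
    {v : Fin r → MvPolynomial (Fin n) K} (hv : IsHomogeneousVec δ a v) :
    IsHomogeneousVec δ a (-v) := by
  intro l m hm
  exact hv l m (by simpa using hm)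

theorem IsHomogeneousVec.single (δ : Fin r → (Fin n →₀ ℕ)) (k : Fin r) :
    IsHomogeneousVec (K := K) δ (δ k) (Pi.single k 1) := by
  intro l m hm
  by_cases h : l = k
  · subst h
    rw [Pi.single_eq_same, mem_support_iff, coeff_one] at hm
    have : m = 0 := by
      by_contra h
      exact hm (if_neg (Ne.symm h))
    simp [this]
  · simp [Pi.single_eq_of_ne h] at hm

theorem IsHomogeneousVec.monomial_smul {δ : Fin r → (Fin n →₀ ℕ)} {a : Fin n →₀ ℕ}
    {v : Fin r → MvPolynomial (Fin n) K} (hv : IsHomogeneousVec δ a v) (u : Fin n →₀ ℕ) :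
    IsHomogeneousVec δ (a + u) (monomial u (1 : K) • v) := by
  classical
  intro l m hm
  rw [Pi.smul_apply, smul_eq_mul, mem_support_iff, coeff_monomial_mul'] at hm
  split_ifs at hm with h
  · rw [one_mul] at hm
    rw [← hv l _ (mem_support_iff.mpr hm), add_right_comm, tsub_add_cancel_of_le h]
  · exact absurd rfl hm

theorem IsHomogeneousVec.map {δ : Fin r → (Fin n →₀ ℕ)} {ε : Fin t → (Fin n →₀ ℕ)}
    {u a : Fin n →₀ ℕ}
    {f : (Fin t → MvPolynomial (Fin n) K) →ₗ[MvPolynomial (Fin n) K]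
      (Fin r → MvPolynomial (Fin n) K)}
    (hf : ∀ k, IsHomogeneousVec δ (ε k + u) (f (Pi.single k 1)))
    {v : Fin t → MvPolynomial (Fin n) K} (hv : IsHomogeneousVec ε a v) :
    IsHomogeneousVec δ (a + u) (f v) := by
  classical
  intro l m hm
  rw [map_eq_sum f v, Finset.sum_apply] at hm
  obtain ⟨k, -, hk⟩ := Finset.mem_biUnion.mp (support_sum hm)
  obtain ⟨x, hx, y, hy, rfl⟩ := Finset.mem_add.mp (support_mul _ _ hk)
  rw [add_assoc, hf k l y hy, ← add_assoc, hv k x hx]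

theorem comp_eq_self {δ : Fin r → (Fin n →₀ ℕ)} {a : Fin n →₀ ℕ}
    {v : Fin r → MvPolynomial (Fin n) K} (hv : IsHomogeneousVec δ a v) : comp δ a v = v := by
  funext l
  ext m
  rw [coeff_comp]
  split_ifs with h
  · rfl
  · by_contra h0
    exact h (hv l m (mem_support_iff.mpr (Ne.symm h0)))

theorem exists_lift
    (d : (Fin t → MvPolynomial (Fin n) K) →ₗ[MvPolynomial (Fin n) K]
      (Fin r → MvPolynomial (Fin n) K))
    (g : (Fin p → MvPolynomial (Fin n) K) →ₗ[MvPolynomial (Fin n) K]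
      (Fin r → MvPolynomial (Fin n) K))
    (Q : Fin p → (Fin t → MvPolynomial (Fin n) K) → Prop)
    (hg : ∀ k, ∃ v, d v = g (Pi.single k 1) ∧ Q k v) :
    ∃ h : (Fin p → MvPolynomial (Fin n) K) →ₗ[MvPolynomial (Fin n) K]
      (Fin t → MvPolynomial (Fin n) K),
      (∀ v, d (h v) = g v) ∧ ∀ k, Q k (h (Pi.single k 1)) := by
  choose c hc hQ using hg
  refine ⟨colMap c, fun v => ?_, fun k => by rw [colMap_single]; exact hQ k⟩
  rw [map_eq_sum g, colMap_apply, map_sum]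
  simp [hc]

/-- Any preimage of a homogeneous vector may be replaced by its component in the right multidegree,
because a homogeneous map commutes with taking components. -/
theorem exists_homogeneous_lift {δ : Fin r → (Fin n →₀ ℕ)} {ε : Fin t → (Fin n →₀ ℕ)}
    {η : Fin p → (Fin n →₀ ℕ)}
    {d : (Fin t → MvPolynomial (Fin n) K) →ₗ[MvPolynomial (Fin n) K]
      (Fin r → MvPolynomial (Fin n) K)}
    (hd : ∀ k, IsHomogeneousVec δ (ε k) (d (Pi.single k 1)))
    {g : (Fin p → MvPolynomial (Fin n) K) →ₗ[MvPolynomial (Fin n) K]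
      (Fin r → MvPolynomial (Fin n) K)}
    (hg : ∀ k, IsHomogeneousVec δ (η k) (g (Pi.single k 1)))
    (hr : ∀ v, g v ∈ LinearMap.range d) :
    ∃ h : (Fin p → MvPolynomial (Fin n) K) →ₗ[MvPolynomial (Fin n) K]
      (Fin t → MvPolynomial (Fin n) K),
      (∀ v, d (h v) = g v) ∧ ∀ k, IsHomogeneousVec ε (η k) (h (Pi.single k 1)) := by
  refine exists_lift d g _ fun k => ?_
  obtain ⟨v, hv⟩ := hr (Pi.single k 1)
  refine ⟨comp ε (η k) v, ?_, isHomogeneousVec_comp _ _ _⟩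
  rw [eq_colMap d, ← comp_colMap δ ε _ hd, ← eq_colMap d, hv, comp_eq_self (hg k)]

theorem map_mem_of_forall_mem (𝔪 : Ideal (MvPolynomial (Fin n) K))
    (f : (Fin t → MvPolynomial (Fin n) K) →ₗ[MvPolynomial (Fin n) K]
      (Fin r → MvPolynomial (Fin n) K)) {v : Fin t → MvPolynomial (Fin n) K}
    (hv : ∀ k, v k ∈ 𝔪) (l : Fin r) : f v l ∈ 𝔪 := by
  rw [map_eq_sum f, Finset.sum_apply]
  exact Submodule.sum_mem _ fun k _ => Ideal.mul_mem_right _ _ (hv k)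

theorem coeff_zero_map (f : (Fin t → MvPolynomial (Fin n) K) →ₗ[MvPolynomial (Fin n) K]
      (Fin r → MvPolynomial (Fin n) K)) (v : Fin t → MvPolynomial (Fin n) K) (l : Fin r) :
    coeff 0 (f v l) = ∑ k, coeff 0 (v k) * coeff 0 (f (Pi.single k 1) l) := by
  rw [map_eq_sum f, Finset.sum_apply, coeff_sum]
  refine Finset.sum_congr rfl fun k _ => ?_
  rw [Pi.smul_apply, smul_eq_mul, ← constantCoeff_eq, map_mul]

theorem coeff_zero_of_mem_idealOfVars {f : MvPolynomial (Fin n) K}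
    (hf : f ∈ idealOfVars (Fin n) K) : coeff 0 f = 0 := by
  rw [idealOfVars, ← Set.image_univ, mem_ideal_span_X_image] at hf
  by_contra h
  obtain ⟨i, -, hi⟩ := hf 0 (mem_support_iff.mpr h)
  exact hi rfl

end Homogeneous

/-! ### Comparison of resolutions and uniqueness of Betti numbers -/

namespace MinimalResolution

variable {K : Type*} [Field K] {n : ℕ} {I I' : Ideal (MvPolynomial (Fin n) K)}

/-- The ranks in the complex `⋯ → F₁ → F₀ → R`. -/
def augRank (F : MinimalResolution I) : ℕ → ℕ
  | 0 => 1
  | s + 1 => F.rank s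

/-- The multidegrees in the complex `⋯ → F₁ → F₀ → R`. -/
noncomputable def augDeg (F : MinimalResolution I) : ∀ s, Fin (F.augRank s) → (Fin n →₀ ℕ)
  | 0 => fun _ => 0
  | s + 1 => F.deg s

/-- The differentials of the complex `⋯ → F₁ → F₀ → R`. -/
noncomputable def augD (F : MinimalResolution I) : ∀ s,
    (Fin (F.augRank (s + 1)) → MvPolynomial (Fin n) K) →ₗ[MvPolynomial (Fin n) K]
      (Fin (F.augRank s) → MvPolynomial (Fin n) K)
  | 0 => LinearMap.pi fun _ => F.aug
  | s + 1 => F.d s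

theorem augD_homogeneous (F : MinimalResolution I) : ∀ s k,
    IsHomogeneousVec (F.augDeg s) (F.augDeg (s + 1) k) (F.augD s (Pi.single k 1))
  | 0, k => by
    intro l m hm
    change m + 0 = F.deg 0 k
    rw [add_zero]
    exact F.aug_homogeneous k m hm
  | s + 1, k => F.d_homogeneous s k

theorem mem_range_augD_zero (F : MinimalResolution I)
    (v : Fin (F.augRank 0) → MvPolynomial (Fin n) K) :
    v ∈ LinearMap.range (F.augD 0) ↔ v (0 : Fin 1) ∈ I := by
  conv_rhs => rw [← F.range_aug]
  constructor
  · rintro ⟨w, rfl⟩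
    exact ⟨w, rfl⟩
  · rintro ⟨w, hw⟩
    refine ⟨w, ?_⟩
    funext l
    exact hw.trans (congrArg v (Subsingleton.elim (α := Fin 1) _ _))

theorem augD_exact (F : MinimalResolution I) : ∀ s, Function.Exact (F.augD (s + 1)) (F.augD s)
  | 0 => by
    intro v
    refine Iff.trans ?_ (F.exact_zero v)
    constructor
    · intro h
      exact congrFun h (0 : Fin 1)
    · intro h
      funext l
      exact h
  | s + 1 => F.exact_succ s

theorem augD_augD (F : MinimalResolution I) (s : ℕ)
    (v : Fin (F.augRank (s + 2)) → MvPolynomial (Fin n) K) :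
    F.augD s (F.augD (s + 1) v) = 0 :=
  (F.augD_exact s).apply_apply_eq_zero v

theorem augD_mem (F : MinimalResolution I) (hI : I ≤ idealOfVars (Fin n) K) : ∀ s v l,
    F.augD s v l ∈ idealOfVars (Fin n) K
  | 0, v, _ => hI ((F.mem_range_augD_zero _).mp ⟨v, rfl⟩)
  | s + 1, v, l => F.minimal s v l

/-- Multiplication by a monomial `x^u` with `x^u I' ⊆ I` lifts to a chain map of resolutions. -/
theorem exists_chainMap (P : MinimalResolution I') (F : MinimalResolution I) (u : Fin n →₀ ℕ)
    (hu : ∀ f ∈ I', monomial u (1 : K) * f ∈ I) :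
    ∃ φ : ∀ s, (Fin (P.augRank s) → MvPolynomial (Fin n) K) →ₗ[MvPolynomial (Fin n) K]
        (Fin (F.augRank s) → MvPolynomial (Fin n) K),
      (∀ v, φ 0 v (0 : Fin 1) = monomial u (1 : K) * v (0 : Fin 1)) ∧
      (∀ s v, F.augD s (φ (s + 1) v) = φ s (P.augD s v)) ∧
      ∀ s k, IsHomogeneousVec (F.augDeg s) (P.augDeg s k + u) (φ s (Pi.single k 1)) := by
  -- The second condition is exactly what makes the next lift possible, so the recursion carries it
  -- along with homogeneity.
  let Good : ∀ s, ((Fin (P.augRank s) → MvPolynomial (Fin n) K) →ₗ[MvPolynomial (Fin n) K]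
        (Fin (F.augRank s) → MvPolynomial (Fin n) K)) → Prop := fun s φ =>
    (∀ k, IsHomogeneousVec (F.augDeg s) (P.augDeg s k + u) (φ (Pi.single k 1))) ∧
      ∀ v, φ (P.augD s v) ∈ LinearMap.range (F.augD s)
  have step : ∀ s (φ : {φ // Good s φ}), ∃ ψ : {ψ // Good (s + 1) ψ},
      ∀ v, F.augD s (ψ.1 v) = φ.1 (P.augD s v) := by
    rintro s ⟨φ, h1, h2⟩
    obtain ⟨ψ, h3, h4⟩ := exists_homogeneous_lift (F.augD_homogeneous s) (g := φ ∘ₗ P.augD s)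
      (η := fun k => P.augDeg (s + 1) k + u)
      (fun k => IsHomogeneousVec.map h1 (P.augD_homogeneous s k)) h2
    refine ⟨⟨ψ, h4, fun v => ?_⟩, h3⟩
    have h5 := (F.augD_exact s (ψ (P.augD (s + 1) v))).mp (by
      rw [h3, LinearMap.comp_apply, P.augD_augD, map_zero])
    exact h5
  choose next hnext using step
  let φ₀ : (Fin 1 → MvPolynomial (Fin n) K) →ₗ[MvPolynomial (Fin n) K]
      (Fin 1 → MvPolynomial (Fin n) K) := monomial u (1 : K) • LinearMap.id
  have hφ₀ : Good 0 φ₀ := by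
    refine ⟨fun k => ?_, fun v => ?_⟩
    · exact (IsHomogeneousVec.single (K := K) (fun _ : Fin 1 => (0 : Fin n →₀ ℕ)) k).monomial_smul u
    · rw [mem_range_augD_zero]
      exact hu _ ((P.mem_range_augD_zero _).mp ⟨v, rfl⟩)
  let φ : ∀ s, {φ // Good s φ} := fun s => Nat.rec ⟨φ₀, hφ₀⟩ next s
  exact ⟨fun s => (φ s).1, fun v => rfl, fun s => hnext s (φ s), fun s => (φ s).2.1⟩

/-- This is the usual null-homotopy of θ - id, built one stage at a time. Only the term h ∘ d is
kept; the remaining difference is a cycle, hence a boundary by exactness. -/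
theorem exists_homotopy (F : MinimalResolution I)
    (θ : ∀ s, (Fin (F.augRank s) → MvPolynomial (Fin n) K) →ₗ[MvPolynomial (Fin n) K]
        (Fin (F.augRank s) → MvPolynomial (Fin n) K))
    (h0 : ∀ v, θ 0 v = v) (hθ : ∀ s v, F.augD s (θ (s + 1) v) = θ s (F.augD s v)) (s : ℕ) :
    ∃ h : (Fin (F.augRank s) → MvPolynomial (Fin n) K) →ₗ[MvPolynomial (Fin n) K]
        (Fin (F.augRank (s + 1)) → MvPolynomial (Fin n) K),
      (∀ v, F.augD s (θ (s + 1) v - v - h (F.augD s v)) = 0) ∧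
      ∀ v l, h (F.augD s v) l ∈ idealOfVars (Fin n) K := by
  induction s with
  | zero =>
    -- Since θ is the identity on R, the homotopy can start at 0. This also settles membership in 𝔪
    -- at this stage, where the differential has image I, which may be the unit ideal.
    refine ⟨0, fun v => ?_, fun v l => by simp⟩
    rw [LinearMap.zero_apply, sub_zero, map_sub, hθ, h0, sub_self]
  | succ s ih =>
    obtain ⟨h, h1, -⟩ := ih
    obtain ⟨k, hk, -⟩ := exists_lift (F.augD (s + 1))
      (θ (s + 1) - LinearMap.id - h ∘ₗ F.augD s) (fun _ _ => True) (fun i => by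
        obtain ⟨w, hw⟩ := (F.augD_exact s _).mp (h1 (Pi.single i 1))
        exact ⟨w, hw, trivial⟩)
    refine ⟨k, fun v => ?_, fun v l => ?_⟩
    · rw [map_sub, map_sub, hk, hθ]
      simp [F.augD_augD]
    · exact map_mem_of_forall_mem _ k (F.minimal s v) l

/-- The difference θ - id is a boundary plus h ∘ d, and by minimality both vanish modulo 𝔪. -/
theorem coeff_zero_endomorphism (F : MinimalResolution I)
    (θ : ∀ s, (Fin (F.augRank s) → MvPolynomial (Fin n) K) →ₗ[MvPolynomial (Fin n) K]
        (Fin (F.augRank s) → MvPolynomial (Fin n) K))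
    (h0 : ∀ v, θ 0 v = v) (hθ : ∀ s v, F.augD s (θ (s + 1) v) = θ s (F.augD s v)) (s : ℕ)
    (v : Fin (F.augRank (s + 1)) → MvPolynomial (Fin n) K) (l : Fin (F.augRank (s + 1))) :
    coeff 0 (θ (s + 1) v l) = coeff 0 (v l) := by
  obtain ⟨h, h1, h2⟩ := F.exists_homotopy θ h0 hθ s
  obtain ⟨w, hw⟩ := (F.augD_exact s _).mp (h1 v)
  have h3 : θ (s + 1) v l = v l + F.augD (s + 1) w l + h (F.augD s v) l := by
    rw [hw]
    simp only [Pi.sub_apply]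
    ring
  have h4 : F.augD (s + 1) w l ∈ idealOfVars (Fin n) K := F.minimal s w l
  rw [h3, coeff_add, coeff_add, coeff_zero_of_mem_idealOfVars h4,
    coeff_zero_of_mem_idealOfVars (h2 v l), add_zero, add_zero]

/-- Comparison maps F → G → F compose to the identity modulo 𝔪. Being homogeneous, they are block
diagonal by multidegree modulo 𝔪, so the identity on the block of degree a factors through that of
G, and ranks compare. -/
theorem betti_le (F G : MinimalResolution I) (s : ℕ) (a : Fin n →₀ ℕ) :
    F.betti s a ≤ G.betti s a := by
  obtain ⟨φ, φ0, φd, φh⟩ := exists_chainMap F G 0 (fun f hf => by simpa using hf)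
  obtain ⟨ψ, ψ0, ψd, -⟩ := exists_chainMap G F 0 (fun f hf => by simpa using hf)
  have key := F.coeff_zero_endomorphism (fun s => ψ s ∘ₗ φ s) (fun v => by
      funext l
      obtain rfl : l = (0 : Fin 1) := Subsingleton.elim (α := Fin 1) _ _
      rw [LinearMap.comp_apply, ψ0, φ0]
      simp) (fun s v => by
      rw [LinearMap.comp_apply, ψd, φd, LinearMap.comp_apply]) s
  let M : Matrix {k // F.augDeg (s + 1) k = a} {k // G.augDeg (s + 1) k = a} K :=
    fun k j => coeff 0 (φ (s + 1) (Pi.single k.1 1) j.1)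
  let N : Matrix {k // G.augDeg (s + 1) k = a} {k // F.augDeg (s + 1) k = a} K :=
    fun j l => coeff 0 (ψ (s + 1) (Pi.single j.1 1) l.1)
  have hMN : M * N = 1 := by
    ext k l
    have h1 := key (Pi.single k.1 1) l.1
    rw [LinearMap.comp_apply, coeff_zero_map (ψ (s + 1))] at h1
    rw [Matrix.mul_apply, Matrix.one_apply]
    calc ∑ j, M k j * N j l
        = ∑ j ∈ Finset.univ.filter (fun j => G.augDeg (s + 1) j = a),
            coeff 0 (φ (s + 1) (Pi.single k.1 1) j) * coeff 0 (ψ (s + 1) (Pi.single j 1) l.1) :=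
          (Finset.sum_subtype _ (by simp) (fun j => coeff 0 (φ (s + 1) (Pi.single k.1 1) j) *
            coeff 0 (ψ (s + 1) (Pi.single j 1) l.1))).symm
      _ = ∑ j, coeff 0 (φ (s + 1) (Pi.single k.1 1) j) *
            coeff 0 (ψ (s + 1) (Pi.single j 1) l.1) := by
          -- A nonzero constant entry can only join basis elements of equal multidegree.
          refine Finset.sum_subset (Finset.subset_univ _) fun j _ hj => ?_
          rw [mul_eq_zero]
          left
          by_contra h
          apply hj
          have h2 := φh (s + 1) k.1 j 0 (mem_support_iff.mpr h)
          rw [zero_add, add_zero] at h2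
          exact Finset.mem_filter.mpr ⟨Finset.mem_univ _, h2.trans k.2⟩
      _ = if k = l then 1 else 0 := by
          rw [h1]
          by_cases h : k = l
          · subst h
            simp
          · rw [if_neg h, Pi.single_eq_of_ne (fun h' => h (Subtype.ext h'.symm)), coeff_zero]
  have hle : Fintype.card {k // F.augDeg (s + 1) k = a} ≤
      Fintype.card {k // G.augDeg (s + 1) k = a} := by
    have h1 : (M * N).rank = Fintype.card {k // F.augDeg (s + 1) k = a} := by
      rw [hMN, Matrix.rank_one]
    rw [← h1]
    exact (Matrix.rank_mul_le_left M N).trans (Matrix.rank_le_card_width M)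
  rw [Fintype.card_subtype, Fintype.card_subtype] at hle
  exact hle

theorem multigradedBetti_eq (F : MinimalResolution I) (s : ℕ) (a : Fin n →₀ ℕ) :
    multigradedBetti I s a = F.betti s a := by
  rw [multigradedBetti, dif_pos ⟨F⟩]
  exact le_antisymm (betti_le _ _ s a) (betti_le _ _ s a)

end MinimalResolution

end MonomialBetti

namespace MonomialBetti

open MvPolynomial

/-! ### Direct sums of free modules -/

section Split

variable {K : Type*} [Field K] {n r t : ℕ}

/-- The decomposition `S^(r + t) = S^r × S^t` for `S = K[x₁, …, xₙ]`. -/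
noncomputable def splitEquiv (K : Type*) [Field K] (n r t : ℕ) :
    (Fin (r + t) → MvPolynomial (Fin n) K) ≃ₗ[MvPolynomial (Fin n) K]
      (Fin r → MvPolynomial (Fin n) K) × (Fin t → MvPolynomial (Fin n) K) :=
  LinearEquiv.funCongrLeft (MvPolynomial (Fin n) K) (MvPolynomial (Fin n) K) finSumFinEquiv ≪≫ₗ
    LinearEquiv.sumArrowLequivProdArrow (Fin r) (Fin t) _ _

theorem splitEquiv_symm_castAdd
    (x : (Fin r → MvPolynomial (Fin n) K) × (Fin t → MvPolynomial (Fin n) K)) (l : Fin r) :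
    (splitEquiv K n r t).symm x (Fin.castAdd t l) = x.1 l := by
  conv_rhs => rw [← (splitEquiv K n r t).apply_symm_apply x]
  rfl

theorem splitEquiv_symm_natAdd
    (x : (Fin r → MvPolynomial (Fin n) K) × (Fin t → MvPolynomial (Fin n) K)) (l : Fin t) :
    (splitEquiv K n r t).symm x (Fin.natAdd r l) = x.2 l := by
  conv_rhs => rw [← (splitEquiv K n r t).apply_symm_apply x]
  rfl

theorem splitEquiv_symm_mem (𝔪 : Ideal (MvPolynomial (Fin n) K))
    {x : (Fin r → MvPolynomial (Fin n) K) × (Fin t → MvPolynomial (Fin n) K)}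
    (h1 : ∀ l, x.1 l ∈ 𝔪) (h2 : ∀ l, x.2 l ∈ 𝔪) (l : Fin (r + t)) :
    (splitEquiv K n r t).symm x l ∈ 𝔪 := by
  refine Fin.addCases (fun l => ?_) (fun l => ?_) l
  · rw [splitEquiv_symm_castAdd]
    exact h1 l
  · rw [splitEquiv_symm_natAdd]
    exact h2 l

theorem splitEquiv_single_castAdd (k : Fin r) :
    splitEquiv K n r t (Pi.single (Fin.castAdd t k) 1) = (Pi.single k 1, 0) := by
  rw [← LinearEquiv.eq_symm_apply]
  funext l
  refine Fin.addCases (fun l => ?_) (fun l => ?_) l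
  · rw [splitEquiv_symm_castAdd]
    simp [Pi.single_apply]
  · rw [splitEquiv_symm_natAdd, Pi.single_eq_of_ne]
    · rfl
    · intro h
      have := congrArg Fin.val h
      simp at this
      omega

theorem splitEquiv_single_natAdd (k : Fin t) :
    splitEquiv K n r t (Pi.single (Fin.natAdd r k) 1) = (0, Pi.single k 1) := by
  rw [← LinearEquiv.eq_symm_apply]
  funext l
  refine Fin.addCases (fun l => ?_) (fun l => ?_) l
  · rw [splitEquiv_symm_castAdd, Pi.single_eq_of_ne]
    · rfl
    · intro h
      have := congrArg Fin.val h
      simp at this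
      omega
  · rw [splitEquiv_symm_natAdd]
    simp [Pi.single_apply]

theorem isHomogeneousVec_splitEquiv_symm {δ : Fin r → (Fin n →₀ ℕ)} {ε : Fin t → (Fin n →₀ ℕ)}
    {a : Fin n →₀ ℕ}
    {x : (Fin r → MvPolynomial (Fin n) K) × (Fin t → MvPolynomial (Fin n) K)}
    (h1 : IsHomogeneousVec δ a x.1) (h2 : IsHomogeneousVec ε a x.2) :
    IsHomogeneousVec (Fin.append δ ε) a ((splitEquiv K n r t).symm x) := by
  intro l
  refine Fin.addCases (fun l => ?_) (fun l => ?_) l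
  · rw [splitEquiv_symm_castAdd, Fin.append_left]
    exact h1 l
  · rw [splitEquiv_symm_natAdd, Fin.append_right]
    exact h2 l

end Split

/-! ### Ideals generated by variables and their colons -/

section VarIdeal

variable {K : Type*} [Field K] {n : ℕ}

theorem varIdeal_le_idealOfVars (B : Finset (Fin n)) : varIdeal K B ≤ idealOfVars (Fin n) K :=
  Ideal.span_mono (Set.image_subset_range _ _)

theorem mem_varIdeal {B : Finset (Fin n)} {f : MvPolynomial (Fin n) K} :
    f ∈ varIdeal K B ↔ ∀ m ∈ f.support, ∃ i ∈ B, m i ≠ 0 :=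
  mem_ideal_span_X_image

theorem mem_varIdeal_of_X_mul_mem {B : Finset (Fin n)} {i : Fin n} (hi : i ∉ B)
    {f : MvPolynomial (Fin n) K} (hf : X i * f ∈ varIdeal K B) : f ∈ varIdeal K B := by
  classical
  rw [mem_varIdeal] at hf ⊢
  intro m hm
  obtain ⟨j, hj, h⟩ := hf (Finsupp.single i 1 + m) (by
    rw [mem_support_iff, coeff_X_mul]
    exact mem_support_iff.mp hm)
  refine ⟨j, hj, ?_⟩
  have hij : j ≠ i := by
    rintro rfl
    exact hi hj
  rwa [Finsupp.add_apply, Finsupp.single_eq_of_ne hij, zero_add] at h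

theorem varIdeal_insert (A : Finset (Fin n)) (i : Fin n) :
    varIdeal K (insert i A) = varIdeal K A + Ideal.span {X i} := by
  rw [varIdeal, Finset.coe_insert, Set.image_insert_eq, Ideal.span_insert, add_comm]
  rfl

theorem varIdeal_union (A B : Finset (Fin n)) :
    varIdeal K (A ∪ B) = varIdeal K A + varIdeal K B := by
  rw [varIdeal, Finset.coe_union, Set.image_union, Ideal.span_union]
  rfl

/-- If `I : f = 𝔟`, then `(I + f 𝔞) : f = 𝔞 + 𝔟`. -/
theorem colon_add_span_mul {R : Type*} [CommRing R] {I 𝔞 𝔟 : Ideal R} {f : R}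
    (h : I.colon {f} = 𝔟) : (I + Ideal.span {f} * 𝔞).colon {f} = 𝔞 + 𝔟 := by
  subst h
  ext g
  rw [Submodule.mem_colon_singleton, smul_eq_mul]
  constructor
  · intro hg
    obtain ⟨y, hy, z, hz, hyz⟩ := Submodule.mem_sup.mp hg
    obtain ⟨w, hw, rfl⟩ := Ideal.mem_span_singleton_mul.mp hz
    refine Submodule.mem_sup.mpr ⟨w, hw, g - w, ?_, by ring⟩
    rw [Submodule.mem_colon_singleton, smul_eq_mul]
    have : (g - w) * f = y := by linear_combination -hyz
    rwa [this]
  · intro hg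
    obtain ⟨w, hw, y, hy, rfl⟩ := Submodule.mem_sup.mp hg
    rw [Submodule.mem_colon_singleton, smul_eq_mul] at hy
    have hfw : f * w ∈ Ideal.span {f} * 𝔞 :=
      Ideal.mul_mem_mul (Ideal.mem_span_singleton_self f) hw
    rw [add_mul, add_comm (w * f), mul_comm w]
    exact Submodule.add_mem_sup hy hfw

end VarIdeal

/-! ### The mapping cone -/

namespace MinimalResolution

variable {K : Type*} [Field K] {n : ℕ} {I : Ideal (MvPolynomial (Fin n) K)}

/-- The mapping cone of multiplication by `x_i` after a lift of multiplication by `x^u` is a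
minimal resolution of `I + (x^u x_i)`. -/
theorem exists_cone (F : MinimalResolution I) {B : Finset (Fin n)}
    (P : MinimalResolution (varIdeal K B)) {u : Fin n →₀ ℕ} {i : Fin n} (hi : i ∉ B)
    (hB : I.colon {monomial u (1 : K)} = varIdeal K B) :
    ∃ G : MinimalResolution (I + Ideal.span {monomial u (1 : K) * X i}), ∀ s a,
      G.betti s a = F.betti s a +
        (Finset.univ.filter fun k => P.augDeg s k + (u + Finsupp.single i 1) = a).card := by
  obtain ⟨φ, φ0, φd, φh⟩ := exists_chainMap P F u (fun f hf => by
    rwa [← hB, Submodule.mem_colon_singleton, smul_eq_mul, mul_comm] at hf)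
  let e := fun s => splitEquiv K n (F.augRank (s + 1)) (P.augRank s)
  -- Keeping the factor x_i outside the lift φ of x^u puts every entry of the comparison map in 𝔪,
  -- which gives minimality of the cone.
  let c : ∀ s, (Fin (F.augRank (s + 1)) → MvPolynomial (Fin n) K) ×
      (Fin (P.augRank s) → MvPolynomial (Fin n) K) →ₗ[MvPolynomial (Fin n) K]
      (Fin (F.augRank s) → MvPolynomial (Fin n) K) := fun s =>
    (F.augD s).coprod ((X i : MvPolynomial (Fin n) K) • φ s)
  have hc : ∀ s x, c s x = F.augD s x.1 + (X i : MvPolynomial (Fin n) K) • φ s x.2 := by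
    intro s x
    simp [c]
  let D : ∀ s, (Fin (F.augRank (s + 1 + 1) + P.augRank (s + 1)) → MvPolynomial (Fin n) K)
      →ₗ[MvPolynomial (Fin n) K] (Fin (F.augRank (s + 1) + P.augRank s) →
        MvPolynomial (Fin n) K) := fun s =>
    (e s).symm.toLinearMap ∘ₗ
      ((c (s + 1)).prod (-(P.augD s ∘ₗ LinearMap.snd _ _ _))) ∘ₗ (e (s + 1)).toLinearMap
  have hD : ∀ s v, D s v = (e s).symm (c (s + 1) (e (s + 1) v), -P.augD s (e (s + 1) v).2) :=
    fun s v => rfl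
  -- If the P-component of a cycle is the boundary of k, then f + x_i φ(k) is a cycle of F, hence a
  -- boundary by exactness.
  have cone_exact : ∀ s (x : (Fin (F.augRank (s + 1)) → MvPolynomial (Fin n) K) ×
      (Fin (P.augRank s) → MvPolynomial (Fin n) K)), c s x = 0 →
      x.2 ∈ LinearMap.range (P.augD s) → ∃ w, D s w = (e s).symm x := by
    rintro s ⟨f, _⟩ h0 ⟨k, rfl⟩
    rw [hc] at h0
    change F.augD s f + (X i : MvPolynomial (Fin n) K) • φ s (P.augD s k) = 0 at h0
    rw [← φd, ← map_smul, ← map_add] at h0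
    obtain ⟨g, hg⟩ := (F.augD_exact s _).mp h0
    refine ⟨(e (s + 1)).symm (g, -k), ?_⟩
    rw [hD, LinearEquiv.apply_symm_apply, hc, hg, map_neg, map_neg, neg_neg]
    simp
  have cD : ∀ s v, c s (e s (D s v)) = 0 := by
    intro s v
    rw [hD, LinearEquiv.apply_symm_apply, hc, hc]
    simp only [map_add, map_neg, F.augD_augD, map_smul, φd, smul_neg]
    simp
  have hDh : ∀ s k, IsHomogeneousVec
      (Fin.append (F.augDeg (s + 1)) fun k => P.augDeg s k + (u + Finsupp.single i 1))
      (Fin.append (F.augDeg (s + 1 + 1))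
        (fun k => P.augDeg (s + 1) k + (u + Finsupp.single i 1)) k) (D s (Pi.single k 1)) := by
    intro s k
    rw [hD]
    refine Fin.addCases (fun k => ?_) (fun k => ?_) k
    · rw [Fin.append_left]
      apply isHomogeneousVec_splitEquiv_symm
      · simp only [e, splitEquiv_single_castAdd, hc, map_zero, smul_zero, add_zero]
        exact F.augD_homogeneous _ k
      · simp only [e, splitEquiv_single_castAdd, map_zero, neg_zero]
        exact IsHomogeneousVec.zero _ _
    · rw [Fin.append_right]
      apply isHomogeneousVec_splitEquiv_symm
      · simp only [e, splitEquiv_single_natAdd, hc, map_zero, zero_add]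
        rw [← add_assoc]
        exact (φh (s + 1) k).monomial_smul (Finsupp.single i 1)
      · simp only [e, splitEquiv_single_natAdd]
        apply IsHomogeneousVec.neg
        intro l m hm
        rw [← add_assoc, P.augD_homogeneous s k l m hm]
  let aug : (Fin (F.augRank 1 + P.augRank 0) → MvPolynomial (Fin n) K)
      →ₗ[MvPolynomial (Fin n) K] MvPolynomial (Fin n) K :=
    LinearMap.proj (R := MvPolynomial (Fin n) K) (φ := fun _ : Fin 1 => MvPolynomial (Fin n) K) 0
      ∘ₗ c 0 ∘ₗ (e 0).toLinearMap
  have haug : ∀ v, aug v = c 0 (e 0 v) (0 : Fin 1) := fun v => rfl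
  let α : (Fin (F.augRank 1) → MvPolynomial (Fin n) K) →ₗ[MvPolynomial (Fin n) K]
      MvPolynomial (Fin n) K := F.aug
  have hα : LinearMap.range α = I := F.range_aug
  have hc0 : ∀ x, c 0 x (0 : Fin 1) =
      α x.1 + X i * (monomial u (1 : K) * x.2 (0 : Fin 1)) := by
    intro x
    rw [← φ0, hc]
    rfl
  refine ⟨{
    rank := fun s => F.augRank (s + 1) + P.augRank s
    deg := fun s => Fin.append (F.augDeg (s + 1)) fun k => P.augDeg s k + (u + Finsupp.single i 1)
    aug := aug
    d := D
    aug_homogeneous := ?_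
    d_homogeneous := hDh
    range_aug := ?_
    exact_zero := ?_
    exact_succ := ?_
    minimal := ?_ }, ?_⟩
  · intro k
    rw [haug, hc0]
    refine Fin.addCases (fun k => ?_) (fun k => ?_) k
    · intro m hm
      simp only [e, splitEquiv_single_castAdd] at hm
      rw [Fin.append_left]
      refine F.aug_homogeneous k m ?_
      erw [Pi.zero_apply, mul_zero, mul_zero, add_zero] at hm
      exact hm
    · intro m hm
      simp only [e, splitEquiv_single_natAdd] at hm
      rw [Fin.append_right]
      obtain rfl : k = (0 : Fin 1) := Subsingleton.elim (α := Fin 1) _ _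
      have h1 : (Pi.single (0 : Fin 1) 1 : Fin 1 → MvPolynomial (Fin n) K) 0 = 1 :=
        Pi.single_eq_same _ _
      erw [h1, map_zero, zero_add, mul_one] at hm
      rw [X, monomial_mul, mul_one] at hm
      have h2 := Finset.mem_singleton.mp (support_monomial_subset hm)
      rw [h2, add_comm (Finsupp.single i 1)]
      exact (zero_add _).symm
  · ext f
    constructor
    · rintro ⟨v, rfl⟩
      rw [haug, hc0]
      refine Submodule.add_mem_sup (hα.le ⟨_, rfl⟩) ?_
      rw [Ideal.mem_span_singleton]
      exact ⟨(e 0 v).2 (0 : Fin 1), by ring⟩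
    · intro hf
      obtain ⟨g, hg, z, hz, rfl⟩ := Submodule.mem_sup.mp hf
      obtain ⟨y, rfl⟩ := hα.ge hg
      obtain ⟨w, rfl⟩ := Ideal.mem_span_singleton.mp hz
      refine ⟨(e 0).symm (y, fun _ => w), ?_⟩
      rw [haug, LinearEquiv.apply_symm_apply, hc0]
      ring
  · intro v
    constructor
    · intro h
      have h0 : c 0 (e 0 v) = 0 := by
        funext l
        obtain rfl : l = (0 : Fin 1) := Subsingleton.elim (α := Fin 1) _ _
        exact h
      -- The P-component g in R satisfies x_i x^u g ∈ I, so x_i g ∈ I : x^u = (x_j : j ∈ B), and i ∉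
      -- B gives g ∈ (x_j : j ∈ B).
      obtain ⟨w, hw⟩ := cone_exact 0 (e 0 v) h0 (by
        rw [mem_range_augD_zero]
        apply mem_varIdeal_of_X_mul_mem hi
        refine hB.le (Submodule.mem_colon_singleton.mpr (hα.le ⟨-(e 0 v).1, ?_⟩))
        rw [haug, hc0] at h
        rw [map_neg, smul_eq_mul]
        linear_combination -h)
      exact ⟨w, by rw [hw, LinearEquiv.symm_apply_apply]⟩
    · rintro ⟨w, rfl⟩
      rw [haug, cD]
      rfl
  · intro s v
    constructor
    · intro h
      rw [hD, LinearEquiv.map_eq_zero_iff, Prod.mk_eq_zero, neg_eq_zero] at h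
      obtain ⟨w, hw⟩ := cone_exact (s + 1) (e (s + 1) v) h.1 ((P.augD_exact s _).mp h.2)
      exact ⟨w, by rw [hw, LinearEquiv.symm_apply_apply]⟩
    · rintro ⟨w, rfl⟩
      rw [hD s, cD, LinearEquiv.map_eq_zero_iff, Prod.mk_eq_zero, hD (s + 1),
        LinearEquiv.apply_symm_apply, map_neg, P.augD_augD]
      simp
  · intro s v
    rw [hD]
    refine splitEquiv_symm_mem _ (fun l => ?_) (fun l => ?_)
    · rw [hc]
      exact Ideal.add_mem _ (F.minimal s _ l)
        (Ideal.mul_mem_right _ _ (Ideal.subset_span ⟨i, rfl⟩))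
    · exact neg_mem (P.augD_mem (varIdeal_le_idealOfVars B) s _ l)
  · intro s a
    unfold betti
    simp only [Finset.card_filter]
    rw [Fin.sum_univ_add]
    simp only [Fin.append_left, Fin.append_right]
    rfl

end MinimalResolution

end MonomialBetti

namespace MonomialBetti

open MvPolynomial

/-! ### Counting squarefree multidegrees -/

section Count

variable {n : ℕ}

/-- The exponent vector of the squarefree monomial with support `T`. -/
noncomputable def sqfreeExp (T : Finset (Fin n)) : Fin n →₀ ℕ :=
  ∑ i ∈ T, Finsupp.single i 1

theorem sqfreeExp_apply (T : Finset (Fin n)) (i : Fin n) :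
    sqfreeExp T i = if i ∈ T then 1 else 0 := by
  simp [sqfreeExp, Finsupp.finsetSum_apply, Finsupp.single_apply]

theorem sqfreeExp_insert {T : Finset (Fin n)} {i : Fin n} (hi : i ∉ T) :
    sqfreeExp (insert i T) = Finsupp.single i 1 + sqfreeExp T :=
  Finset.sum_insert hi

theorem degree_sqfreeExp (T : Finset (Fin n)) : (sqfreeExp T).degree = T.card := by
  simp [sqfreeExp]

theorem add_sqfreeExp_eq_iff (u a : Fin n →₀ ℕ) (T : Finset (Fin n)) :
    u + sqfreeExp T = a ↔ (∀ i, (a i : ℤ) - (u i : ℤ) = 0 ∨ (a i : ℤ) - (u i : ℤ) = 1) ∧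
      (Finset.univ.filter fun i => (a i : ℤ) - (u i : ℤ) ≠ 0) = T := by
  rw [DFunLike.ext_iff]
  simp only [Finsupp.add_apply, sqfreeExp_apply, Finset.ext_iff, Finset.mem_filter,
    Finset.mem_univ, true_and, ← forall_and]
  refine forall_congr' fun i => ?_
  by_cases h : i ∈ T
  · simp only [h, if_true, iff_true]
    omega
  · simp only [h, if_false, iff_false]
    omega

/-- The number of `s`-element subsets `T` of `C` with `x^u ∏_{i ∈ T} x_i = x^a`. -/
noncomputable def subsetCount (u : Fin n →₀ ℕ) (s : ℕ) (C : Finset (Fin n)) (a : Fin n →₀ ℕ) : ℕ :=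
  ((C.powersetCard s).filter fun T => u + sqfreeExp T = a).card

/-- Multigraded Pascal rule: subsets are split by whether they contain i. The second term matches
the contribution of P to the mapping cone. -/
theorem subsetCount_insert (u : Fin n →₀ ℕ) (s : ℕ) {C : Finset (Fin n)} {i : Fin n} (hi : i ∉ C)
    (a : Fin n →₀ ℕ) : subsetCount u (s + 1) (insert i C) a =
      subsetCount u (s + 1) C a + subsetCount (u + Finsupp.single i 1) s C a := by
  have hmem : ∀ {r T}, T ∈ C.powersetCard r → i ∉ T := fun hT h =>
    hi ((Finset.mem_powersetCard.mp hT).1 h)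
  unfold subsetCount
  rw [Finset.powersetCard_succ_insert hi, Finset.filter_union, Finset.card_union_of_disjoint]
  · congr 1
    rw [Finset.filter_image, Finset.card_image_of_injOn]
    · refine congrArg Finset.card (Finset.filter_congr fun T hT => ?_)
      rw [sqfreeExp_insert (hmem hT), add_assoc]
    · intro T hT T' hT' h
      rw [← Finset.erase_insert (hmem (Finset.mem_filter.mp hT).1),
        ← Finset.erase_insert (hmem (Finset.mem_filter.mp hT').1)]
      exact congrArg (Finset.erase · i) h
  · rw [Finset.disjoint_left]
    intro T hT hT'
    obtain ⟨T', -, rfl⟩ := Finset.mem_image.mp (Finset.mem_filter.mp hT').1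
    exact hmem (Finset.mem_filter.mp hT).1 (Finset.mem_insert_self _ _)

/-- The set T is recovered from a as the support of a - u, so at most one subset is counted. -/
theorem subsetCount_eq (u : Fin n →₀ ℕ) (s : ℕ) (C : Finset (Fin n)) (a : Fin n →₀ ℕ) :
    subsetCount u s C a =
      if (∀ i, (a i : ℤ) - (u i : ℤ) = 0 ∨ (a i : ℤ) - (u i : ℤ) = 1) ∧
        (Finset.univ.filter fun i => (a i : ℤ) - (u i : ℤ) ≠ 0) ∈ C.powersetCard s
      then 1 else 0 := by
  unfold subsetCount
  split_ifs with h
  · rw [Finset.card_eq_one]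
    refine ⟨_, Finset.eq_singleton_iff_unique_mem.mpr
      ⟨Finset.mem_filter.mpr ⟨h.2, (add_sqfreeExp_eq_iff u a _).mpr ⟨h.1, rfl⟩⟩, fun T hT => ?_⟩⟩
    exact ((add_sqfreeExp_eq_iff u a T).mp (Finset.mem_filter.mp hT).2).2.symm
  · refine Finset.card_eq_zero.mpr (Finset.filter_eq_empty_iff.mpr fun T hT hTa => h ?_)
    obtain ⟨h1, h2⟩ := (add_sqfreeExp_eq_iff u a T).mp hTa
    exact ⟨h1, h2 ▸ hT⟩

theorem sum_subsetCount (u : Fin n →₀ ℕ) (s j : ℕ) (hj : u.degree + s = j) (C : Finset (Fin n)) :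
    ∑ a ∈ (Finset.univ : Finset (Fin n)).finsuppAntidiag j, subsetCount u s C a =
      C.card.choose s := by
  rw [← Finset.card_powersetCard]
  refine (Finset.card_eq_sum_card_fiberwise fun T hT => ?_).symm
  have hT' := (Finset.mem_powersetCard.mp hT).2
  refine Finset.mem_coe.mpr (Finset.mem_finsuppAntidiag.mpr ⟨?_, Finset.subset_univ _⟩)
  rw [← Finsupp.degree_eq_sum, map_add, degree_sqfreeExp, hT', hj]

end Count

/-! ### Iterating the cone -/

namespace MinimalResolution

variable {K : Type*} [Field K] {n : ℕ} {I : Ideal (MvPolynomial (Fin n) K)}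

/-- Augmenting by R shifts the homological index by one. The extra generator of R, in degree 0,
matches the empty subset. -/
theorem card_augDeg_add_eq (P : MinimalResolution I) {B : Finset (Fin n)}
    (hP : ∀ s a, P.betti s a = subsetCount 0 (s + 1) B a) (s : ℕ) (w a : Fin n →₀ ℕ) :
    (Finset.univ.filter fun k => P.augDeg s k + w = a).card = subsetCount w s B a := by
  by_cases hwa : w ≤ a
  · obtain ⟨b, rfl⟩ := exists_add_of_le hwa
    have h1 : subsetCount w s B (w + b) = subsetCount 0 s B b := by
      simp only [subsetCount, add_right_inj, zero_add]
    rw [h1, add_comm w]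
    simp only [add_left_inj]
    cases s with
    | zero =>
      simp only [subsetCount, Finset.powersetCard_zero, Finset.filter_singleton, zero_add]
      change (Finset.univ.filter fun _ : Fin 1 => (0 : Fin n →₀ ℕ) = b).card =
        (if (0 : Fin n →₀ ℕ) = b then {∅} else ∅ : Finset (Finset (Fin n))).card
      by_cases h : (0 : Fin n →₀ ℕ) = b
      · simp [h]
      · simp [h]
    | succ s => exact hP s b
  · rw [subsetCount, Finset.card_eq_zero.mpr, Finset.card_eq_zero.mpr]
    · refine Finset.filter_eq_empty_iff.mpr fun T _ h => hwa ?_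
      rw [← h]
      exact le_self_add
    · refine Finset.filter_eq_empty_iff.mpr fun k _ h => hwa ?_
      rw [← h]
      exact le_add_self

theorem exists_of_varIdeal (K : Type*) [Field K] {n : ℕ} (B : Finset (Fin n)) :
    ∃ P : MinimalResolution (varIdeal K B), ∀ s a, P.betti s a = subsetCount 0 (s + 1) B a := by
  induction B using Finset.induction_on with
  | empty =>
    refine ⟨{
      rank := fun _ => 0
      deg := fun _ _ => 0
      aug := 0
      d := fun _ => 0
      aug_homogeneous := fun k => k.elim0
      d_homogeneous := fun _ k => k.elim0
      range_aug := by simp [varIdeal]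
      exact_zero := fun v => by simp [Subsingleton.elim v 0]
      exact_succ := fun i v => by simp [Subsingleton.elim v 0]
      minimal := fun i v l => l.elim0 }, fun s a => ?_⟩
    rw [subsetCount, Finset.powersetCard_eq_empty.mpr (by simp)]
    rfl
  | insert i B hi ih =>
    obtain ⟨P, hP⟩ := ih
    -- With u = 0 the colon ideal is the ideal itself, so P serves as both ends of the cone: this is
    -- the inductive step of the Koszul complex.
    obtain ⟨G, hG⟩ := exists_cone P P (u := 0) hi (by
      ext f
      rw [Submodule.mem_colon_singleton, smul_eq_mul, monomial_zero', C_1, mul_one])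
    have hins : varIdeal K B + Ideal.span {monomial 0 (1 : K) * X i} = varIdeal K (insert i B) := by
      rw [monomial_zero', C_1, one_mul, ← varIdeal_insert]
    rw [← hins]
    refine ⟨G, fun s a => ?_⟩
    rw [hG, hP, card_augDeg_add_eq P hP, subsetCount_insert _ _ hi]

/-- Induction on A, one cone for each i ∉ B. The count for B stands on the left to avoid truncated
subtraction. -/
theorem exists_add_span_mul (F : MinimalResolution I) {B : Finset (Fin n)} {u : Fin n →₀ ℕ}
    (hB : I.colon {monomial u (1 : K)} = varIdeal K B) (A : Finset (Fin n)) :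
    ∃ G : MinimalResolution (I + Ideal.span {monomial u (1 : K)} * varIdeal K A), ∀ s a,
      G.betti s a + subsetCount u (s + 1) B a =
        F.betti s a + subsetCount u (s + 1) (A ∪ B) a := by
  induction A using Finset.induction_on with
  | empty =>
    have h : I + Ideal.span {monomial u (1 : K)} * varIdeal K ∅ = I := by simp [varIdeal]
    rw [h]
    exact ⟨F, fun s a => by rw [Finset.empty_union]⟩
  | insert i A hi ih =>
    obtain ⟨G, hG⟩ := ih
    have hadd : I + Ideal.span {monomial u (1 : K)} * varIdeal K (insert i A) =
        (I + Ideal.span {monomial u (1 : K)} * varIdeal K A) +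
          Ideal.span {monomial u (1 : K) * X i} := by
      rw [varIdeal_insert, mul_add, Ideal.span_singleton_mul_span_singleton, add_assoc]
    rw [hadd, Finset.insert_union]
    by_cases hiB : i ∈ B
    · have hle : Ideal.span {monomial u (1 : K) * X i} ≤
          I + Ideal.span {monomial u (1 : K)} * varIdeal K A := by
        rw [Ideal.span_singleton_le_iff_mem]
        refine Submodule.mem_sup_left ?_
        rw [mul_comm, ← smul_eq_mul, ← Submodule.mem_colon_singleton, hB]
        exact Ideal.subset_span ⟨i, hiB, rfl⟩
      rw [Submodule.add_eq_sup, sup_eq_left.mpr hle,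
        Finset.insert_eq_of_mem (Finset.mem_union_right _ hiB)]
      exact ⟨G, hG⟩
    · have hi' : i ∉ A ∪ B := by simp [hi, hiB]
      obtain ⟨P, hP⟩ := exists_of_varIdeal K (A ∪ B)
      obtain ⟨H, hH⟩ := exists_cone G P hi' (by rw [colon_add_span_mul hB, varIdeal_union])
      refine ⟨H, fun s a => ?_⟩
      rw [hH, card_augDeg_add_eq P hP, subsetCount_insert _ _ hi', ← add_assoc, ← hG]
      ring

end MinimalResolution

theorem multigradedBetti_add_subsetCount {K : Type*} [Field K] {n : ℕ}
    {I : Ideal (MvPolynomial (Fin n) K)} (hI : Nonempty (MinimalResolution I))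
    {B : Finset (Fin n)} {u : Fin n →₀ ℕ}
    (hB : I.colon {monomial u (1 : K)} = varIdeal K B) (A : Finset (Fin n)) (s : ℕ)
    (a : Fin n →₀ ℕ) :
    multigradedBetti (I + Ideal.span {monomial u (1 : K)} * varIdeal K A) s a +
        subsetCount u (s + 1) B a =
      multigradedBetti I s a + subsetCount u (s + 1) (A ∪ B) a := by
  obtain ⟨F⟩ := hI
  obtain ⟨G, hG⟩ := F.exists_add_span_mul hB A
  rw [G.multigradedBetti_eq, F.multigradedBetti_eq, hG]

end MonomialBetti

/-! ### The two formulas -/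

theorem proposition3p13 {K : Type*} [Field K] {n : ℕ} (d : ℕ)
    (I : Ideal (MvPolynomial (Fin n) K)) (u : Fin n →₀ ℕ)
    (hu : MonomialBetti.IsStronglyLinear I d u)
    (A B : Finset (Fin n))
    (hB : I.colon {MvPolynomial.monomial u (1 : K)} = MonomialBetti.varIdeal K B)
    (J : Ideal (MvPolynomial (Fin n) K))
    (hJ : J = I + Ideal.span {MvPolynomial.monomial u (1 : K)} * MonomialBetti.varIdeal K A) :
    (∀ (s : ℕ) (a : Fin n →₀ ℕ),
      MonomialBetti.multigradedBetti J s a = MonomialBetti.multigradedBetti I s a +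
        if a.degree = d + s ∧
            (∀ i, (a i : ℤ) - (u i : ℤ) = 0 ∨ (a i : ℤ) - (u i : ℤ) = 1) ∧
            (Finset.univ.filter fun i => (a i : ℤ) - (u i : ℤ) ≠ 0) ∈
              (A ∪ B).powersetCard (s + 1) \ B.powersetCard (s + 1)
          then 1 else 0) ∧
    (∀ s : ℕ,
      (MonomialBetti.gradedBetti J s (d + s) : ℤ) = MonomialBetti.gradedBetti I s (d + s) +
        (A ∪ B).card.choose (s + 1) - B.card.choose (s + 1)) := by
  obtain ⟨⟨S, -, hS⟩, hdeg, -⟩ := hu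
  have key := MonomialBetti.multigradedBetti_add_subsetCount
    (MonomialBetti.nonempty_minimalResolution I S hS) hB A
  rw [← hJ] at key
  refine ⟨fun s a => ?_, fun s => ?_⟩
  · have h := key s a
    -- The degree condition follows from the other two: |a| = |u| + (s + 1) = d + s.
    have hdegree : (∀ i, (a i : ℤ) - (u i : ℤ) = 0 ∨ (a i : ℤ) - (u i : ℤ) = 1) →
        (Finset.univ.filter fun i => (a i : ℤ) - (u i : ℤ) ≠ 0) ∈ (A ∪ B).powersetCard (s + 1) →
        a.degree = d + s := by
      intro h1 h2
      have h3 := (MonomialBetti.add_sqfreeExp_eq_iff u a _).mpr ⟨h1, rfl⟩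
      rw [← h3, map_add, MonomialBetti.degree_sqfreeExp, (Finset.mem_powersetCard.mp h2).2]
      omega
    -- By this inclusion the difference of the two indicators is the indicator of the set
    -- difference.
    have hsub := @Finset.powersetCard_mono _ (s + 1) B (A ∪ B) Finset.subset_union_right
    rw [MonomialBetti.subsetCount_eq, MonomialBetti.subsetCount_eq] at h
    generalize (Finset.univ.filter fun i => (a i : ℤ) - (u i : ℤ) ≠ 0) = T at h hdegree ⊢
    by_cases h1 : ∀ i, (a i : ℤ) - (u i : ℤ) = 0 ∨ (a i : ℤ) - (u i : ℤ) = 1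
    · by_cases h2 : T ∈ (A ∪ B).powersetCard (s + 1)
      · have h3 := hdegree h1 h2
        by_cases h4 : T ∈ B.powersetCard (s + 1)
        · rw [if_pos ⟨h1, h4⟩, if_pos ⟨h1, h2⟩] at h
          rw [if_neg fun h5 => (Finset.mem_sdiff.mp h5.2.2).2 h4]
          omega
        · rw [if_neg fun h5 => h4 h5.2, if_pos ⟨h1, h2⟩] at h
          rw [if_pos ⟨h3, h1, Finset.mem_sdiff.mpr ⟨h2, h4⟩⟩]
          omega
      · rw [if_neg fun h5 => h2 (hsub h5.2), if_neg fun h5 => h2 h5.2] at h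
        rw [if_neg fun h5 => h2 (Finset.mem_sdiff.mp h5.2.2).1]
        omega
    · rw [if_neg fun h5 => h1 h5.1, if_neg fun h5 => h1 h5.1] at h
      rw [if_neg fun h5 => h1 h5.2.1]
      omega
  · have h := Finset.sum_congr (rfl : (Finset.univ : Finset (Fin n)).finsuppAntidiag (d + s) = _)
      fun a _ => key s a
    rw [Finset.sum_add_distrib, Finset.sum_add_distrib,
      MonomialBetti.sum_subsetCount u (s + 1) (d + s) (by omega),
      MonomialBetti.sum_subsetCount u (s + 1) (d + s) (by omega)] at h
    unfold MonomialBetti.gradedBetti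
    omega
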